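/- Let $X^n$ be uniformly distributed on $\{-1,1\}^n$ and, for $\rho\in[0,1]$, let $Y^n$ be obtained from $X^n$ by flipping each coordinate independently with probability $\delta=(1-\rho)/2$. For a Boolean function $f:\{-1,1\}^n\to\{-1,1\}$ put $T_\rho f(y^n)=\mathbb{E}\left(f(X^n)\mid Y^n=y^n\right)$. The function $f$ is called $\rho$-self-predicting ($\rho$-SP) if, for every $y^n\in\{-1,1\}^n$ with $T_\rho f(y^n)\neq 0$, one has $f(y^n)=\operatorname{sgn}T_\rho f(y^n)$. Let $h(t)=-t\log_2 t-(1-t)\log_2(1-t)$ denote the binary entropy function. Theorem. For every fixed $\alpha>1$ there is a function $r:\mathbb{N}\to\mathbb{R}$ with $r(n)=o(n)$ as $n\to\infty$ (it may depend on $\alpha$) such that for every $n\ge 2\alpha$ and $\rho=1-\frac{2\alpha}{n}$ (so that $\rho\in[0,1]$), the fraction of $\rho$-SP functions among all $2^{2^n}$ Boolean functions on $n$ variables is at most $$\exp\left(-2^{\,n\cdot h\left(\frac{\alpha-1}{2\alpha}\right)+r(n)}\right).$$ -/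

import Mathlib

open Filter Asymptotics

noncomputable section

namespace SelfPredicting

/-- The Hamming cube `{-1,1}^n`; the alphabet `{-1,1}` is the group of units of `ℤ`. -/
abbrev Cube (n : ℕ) : Type := Fin n → ℤˣ

/-- Boolean functions `f : {-1,1}^n → {-1,1}`. -/
abbrev BoolFun (n : ℕ) : Type := Cube n → ℤˣ

/-- The joint probability mass function `p(x,y)` of the pair `(X,Y)`, where `X` is uniform on the
cube and `Y` is obtained from `X` by flipping each coordinate independently with probability
`δ = (1 - ρ) / 2`. -/
def jointPmf {n : ℕ} (ρ : ℝ) (x y : Cube n) : ℝ :=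
  (1 / 2 : ℝ) ^ n * ∏ i, if y i = x i then 1 - (1 - ρ) / 2 else (1 - ρ) / 2

/-- The marginal probability mass function `p(y)` of `Y`. -/
def marginalPmf {n : ℕ} (ρ : ℝ) (y : Cube n) : ℝ :=
  ∑ x, jointPmf ρ x y

/-- The conditional probability mass function `p(x ∣ y)` of `X` given `Y = y`. -/
def condPmf {n : ℕ} (ρ : ℝ) (x y : Cube n) : ℝ :=
  jointPmf ρ x y / marginalPmf ρ y

/-- The noise operator `T_ρ f (y) = E (f(X) ∣ Y = y)`. -/
def noiseOp {n : ℕ} (ρ : ℝ) (f : BoolFun n) (y : Cube n) : ℝ :=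
  ∑ x, condPmf ρ x y * ((f x : ℤ) : ℝ)

/-- `f` is `ρ`-self-predicting at `y`: it agrees with the optimal predictor `sgn T_ρ f` at `y`
unless the latter is tied. -/
def IsSPAt {n : ℕ} (ρ : ℝ) (f : BoolFun n) (y : Cube n) : Prop :=
  noiseOp ρ f y ≠ 0 → ((f y : ℤ) : ℝ) = Real.sign (noiseOp ρ f y)

/-- `f` is `ρ`-self-predicting: it is so at every point of the cube. -/
def IsSP {n : ℕ} (ρ : ℝ) (f : BoolFun n) : Prop :=
  ∀ y, IsSPAt ρ f y

/-- The fraction of `ρ`-self-predicting functions among all Boolean functions on `n` variables. -/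
def fractionSP (n : ℕ) (ρ : ℝ) : ℝ :=
  (Nat.card {f : BoolFun n // IsSP ρ f} : ℝ) / (Nat.card (BoolFun n) : ℝ)

/-- The binary entropy function, with logarithms in base `2`. -/
def binEnt (t : ℝ) : ℝ :=
  -t * Real.logb 2 t - (1 - t) * Real.logb 2 (1 - t)

end SelfPredicting

end

/-!
If `f` is self-predicting at `y`, then `f y * T_ρ f y ≥ 0`. For `ρ = 1 - 2 * α / n` the noise flips
`α` coordinates on average, so the correlation `f y * T_ρ f y` is determined, up to an arbitrarily
small error, by the values of `f` within a constant distance `K` of `y`.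

At a fixed `y`, for random `f`, this truncated correlation is negative by more than the error with
probability at least `C(n, j) / 2^(n+1)`, where `j` is close to `n (α - 1) / (2 * α)`. Indeed, with
probability `C(n, j) / 2^n` exactly `j` neighbours of `y` agree with it. The terms of `y` and its
neighbours then have a negative sum, and since changing the sign of `f` at all other points changes
the sign of the sum of the remaining terms, that sum is nonpositive in at least half of the cases.

For the points `y` of a code of minimum distance greater than `2 * K` the truncated correlations
depend on disjoint sets of values of `f`, hence are independent. By the Gilbert–Varshamov bound
there is a code with at least `2^n / (e n^(2 * K))` points, so the fraction of self-predicting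
functions is at most `exp (-C(n, j) / (2 e n^(2 * K)))`, and `C(n, j)` is `2^(n h(j/n))` up to a
polynomial factor.
-/

namespace SelfPredicting

open Finset

section HammingCount

variable {ι β : Type*} [Fintype ι] [DecidableEq β]

theorem prod_ite_eq_pow_mul_pow_hammingDist {R : Type*} [CommMonoid R] (a b : R) (x y : ι → β) :
    ∏ i, (if x i = y i then a else b) =
      a ^ (Fintype.card ι - hammingDist x y) * b ^ hammingDist x y := by
  have hagree : #{i | x i = y i} = Fintype.card ι - hammingDist x y := by
    rw [← card_univ, ← card_filter_add_card_filter_not (s := univ) (fun i => x i = y i)]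
    exact (Nat.add_sub_cancel_right _ _).symm
  rw [prod_ite, prod_const, prod_const, hagree]
  rfl

variable [Fintype β]

theorem sum_ite_eq_add_card_sub_one_mul {R : Type*} [CommSemiring R] (a b : R) (u : β) :
    ∑ v, (if u = v then a else b) = a + ((Fintype.card β - 1 : ℕ) : R) * b := by
  rw [Fintype.sum_eq_add_sum_compl u, if_pos rfl, sum_congr rfl (g := fun _ => b) fun v hv =>
    if_neg (by simpa [eq_comm] using hv), sum_const, card_compl, card_singleton, nsmul_eq_mul]

variable [DecidableEq ι]

theorem sum_pow_mul_pow_hammingDist {R : Type*} [CommSemiring R] (a b : R) (y : ι → β) :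
    ∑ x, a ^ (Fintype.card ι - hammingDist y x) * b ^ hammingDist y x =
      (a + ((Fintype.card β - 1 : ℕ) : R) * b) ^ Fintype.card ι := by
  simp_rw [← prod_ite_eq_pow_mul_pow_hammingDist]
  rw [← Fintype.prod_sum fun i v => if y i = v then a else b]
  simp only [sum_ite_eq_add_card_sub_one_mul, prod_const, card_univ]

theorem card_filter_hammingDist_eq (y : ι → β) (j : ℕ) :
    #{x | hammingDist y x = j} = (Fintype.card β - 1) ^ j * (Fintype.card ι).choose j := by
  have hgen := congrArg (Polynomial.coeff · j)
    (sum_pow_mul_pow_hammingDist (1 : Polynomial ℕ) Polynomial.X y)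
  simp only [one_pow, one_mul, Polynomial.finsetSum_coeff, Polynomial.coeff_X_pow] at hgen
  rw [card_filter, mul_comm]
  simp only [eq_comm (b := j), hgen]
  have hcomp : (1 + ((Fintype.card β - 1 : ℕ) : Polynomial ℕ) * Polynomial.X) ^ Fintype.card ι =
      ((1 + Polynomial.X) ^ Fintype.card ι).comp
        (Polynomial.C (Fintype.card β - 1) * Polynomial.X) := by
    simp
  rw [hcomp, Polynomial.comp_C_mul_X_coeff, Polynomial.coeff_one_add_X_pow, Nat.cast_id]

/-- The closed ball of radius `m` around `y` in the Hamming metric, as a finset. -/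
def hammingBall (y : ι → β) (m : ℕ) : Finset (ι → β) := {x | hammingDist y x ≤ m}

theorem mem_hammingBall {x y : ι → β} {m : ℕ} : x ∈ hammingBall y m ↔ hammingDist y x ≤ m := by
  simp [hammingBall]

theorem disjoint_hammingBall {x y : ι → β} {m : ℕ} (h : 2 * m < hammingDist x y) :
    Disjoint (hammingBall x m) (hammingBall y m) := by
  refine disjoint_left.2 fun z hx hy => ?_
  rw [mem_hammingBall] at hx hy
  have := hammingDist_triangle_right x y z
  omega

theorem pow_mul_card_hammingBall_le {t : ℝ} (ht0 : 0 ≤ t) (ht1 : t ≤ 1) (m : ℕ) (y : ι → β) :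
    t ^ m * #(hammingBall y m) ≤ (1 + ((Fintype.card β - 1 : ℕ) : ℝ) * t) ^ Fintype.card ι := by
  calc t ^ m * #(hammingBall y m) = ∑ _x ∈ hammingBall y m, t ^ m := by
        rw [sum_const, nsmul_eq_mul, mul_comm]
    _ ≤ ∑ x ∈ hammingBall y m, t ^ hammingDist y x :=
        sum_le_sum fun x hx => pow_le_pow_of_le_one ht0 ht1 (mem_hammingBall.1 hx)
    _ ≤ ∑ x, t ^ hammingDist y x :=
        sum_le_univ_sum_of_nonneg fun _ => by positivity
    _ = _ := by simp [← sum_pow_mul_pow_hammingDist 1 t y]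

theorem pow_mul_sum_compl_hammingBall_le {a b t : ℝ} (ha : 0 ≤ a) (hb : 0 ≤ b) (ht : 1 ≤ t)
    (m : ℕ) (y : ι → β) :
    t ^ m * ∑ x ∈ (hammingBall y m)ᶜ,
        a ^ (Fintype.card ι - hammingDist y x) * b ^ hammingDist y x ≤
      (a + ((Fintype.card β - 1 : ℕ) : ℝ) * (t * b)) ^ Fintype.card ι := by
  have : 0 ≤ t := zero_le_one.trans ht
  calc t ^ m * ∑ x ∈ (hammingBall y m)ᶜ,
          a ^ (Fintype.card ι - hammingDist y x) * b ^ hammingDist y x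
      ≤ ∑ x ∈ (hammingBall y m)ᶜ,
          a ^ (Fintype.card ι - hammingDist y x) * (t * b) ^ hammingDist y x := by
        rw [mul_sum]
        refine sum_le_sum fun x hx => ?_
        rw [mem_compl, mem_hammingBall, not_le] at hx
        rw [mul_pow, mul_left_comm]
        gcongr
    _ ≤ ∑ x, a ^ (Fintype.card ι - hammingDist y x) * (t * b) ^ hammingDist y x :=
        sum_le_univ_sum_of_nonneg fun _ => by positivity
    _ = _ := sum_pow_mul_pow_hammingDist a (t * b) y

theorem card_hammingBall_le [Nonempty ι] (m : ℕ) (y : ι → β) :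
    (#(hammingBall y m) : ℝ) ≤
      Real.exp (Fintype.card β - 1 : ℕ) * (Fintype.card ι : ℝ) ^ m := by
  set n : ℝ := (Fintype.card ι : ℝ)
  set q : ℝ := ((Fintype.card β - 1 : ℕ) : ℝ)
  have hn : 1 ≤ n := Nat.one_le_cast.2 Fintype.card_pos
  have hn0 : 0 < n := one_pos.trans_le hn
  have hchernoff := pow_mul_card_hammingBall_le (inv_nonneg.2 hn0.le) (inv_le_one_of_one_le₀ hn) m y
  rw [inv_pow, inv_mul_le_iff₀ (by positivity), mul_comm] at hchernoff
  refine hchernoff.trans (mul_le_mul_of_nonneg_right ?_ (by positivity))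
  calc (1 + q * n⁻¹) ^ Fintype.card ι ≤ Real.exp (q * n⁻¹) ^ Fintype.card ι := by
        gcongr
        rw [add_comm]
        exact Real.add_one_le_exp _
    _ = Real.exp q := by
        rw [← Real.exp_nat_mul, mul_left_comm, mul_inv_cancel₀ hn0.ne', mul_one]

end HammingCount

section Code

theorem exists_pairwise_not_and_forall_exists {X : Type*} [Finite X] (r : X → X → Prop)
    [Std.Refl r] [Std.Symm r] :
    ∃ C : Finset X, (C : Set X).Pairwise (fun x y => ¬ r x y) ∧ ∀ x, ∃ y ∈ C, r y x := by
  classical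
  obtain ⟨C, hC⟩ := (Set.toFinite {C : Finset X |
    (C : Set X).Pairwise fun x y => ¬ r x y}).exists_maximal ⟨∅, by simp⟩
  refine ⟨C, hC.prop, fun x => ?_⟩
  by_contra! hx
  have hinsert : ((insert x C : Finset X) : Set X).Pairwise fun x y => ¬ r x y := by
    rw [coe_insert]
    exact hC.prop.insert fun y hy _ => ⟨fun h => hx y hy (symm_of r h), hx y hy⟩
  exact hx x (hC.le_of_ge hinsert (subset_insert x C) (mem_insert_self x C)) (refl_of r x)

theorem exists_pairwise_lt_hammingDist_card_le {ι β : Type*} [Fintype ι] [Nonempty ι]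
    [Fintype β] [DecidableEq β] (m : ℕ) :
    ∃ C : Finset (ι → β), (C : Set (ι → β)).Pairwise (fun x y => m < hammingDist x y) ∧
      (Fintype.card β : ℝ) ^ Fintype.card ι ≤
        #C * (Real.exp (Fintype.card β - 1 : ℕ) * (Fintype.card ι : ℝ) ^ m) := by
  classical
  let close : (ι → β) → (ι → β) → Prop := fun x y => hammingDist x y ≤ m
  have : Std.Refl close := ⟨fun x => by simp [close]⟩
  have : Std.Symm close := ⟨fun x y h => (hammingDist_comm y x).trans_le h⟩
  obtain ⟨C, hsep, hcover⟩ := exists_pairwise_not_and_forall_exists close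
  refine ⟨C, hsep.mono' fun x y => not_le.1, ?_⟩
  have hbiUnion : C.biUnion (hammingBall · m) = univ :=
    eq_univ_iff_forall.2 fun x => by simpa [mem_hammingBall] using hcover x
  calc (Fintype.card β : ℝ) ^ Fintype.card ι = #(C.biUnion (hammingBall · m)) := by
        simp [hbiUnion]
    _ ≤ ∑ y ∈ C, (#(hammingBall y m) : ℝ) := by exact_mod_cast card_biUnion_le
    _ ≤ #C * (Real.exp (Fintype.card β - 1 : ℕ) * (Fintype.card ι : ℝ) ^ m) := by
        rw [← nsmul_eq_mul]
        exact sum_le_card_nsmul _ _ _ fun y _ => card_hammingBall_le m y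

end Code

section Density

variable {ι κ : Type*} {π : ι → Type*} [Fintype ι] [DecidableEq ι] [∀ i, Fintype (π i)]

/-- Exchanging the coordinates in `S` between `f` and `g` matches the pairs with `P f ∧ Q f` with
those with `P f` and `Q g`. -/
theorem dens_filter_and_of_dependsOn {S T : Set ι} (hST : Disjoint S T)
    {P Q : (∀ i, π i) → Prop} [DecidablePred P] [DecidablePred Q]
    (hP : DependsOn P S) (hQ : DependsOn Q T) :
    dens {f | P f ∧ Q f} = dens {f | P f} * dens {f | Q f} := by
  classical
  let swap : (∀ i, π i) × (∀ i, π i) → (∀ i, π i) × (∀ i, π i) :=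
    fun p => (S.piecewise p.1 p.2, S.piecewise p.2 p.1)
  have hswap : Function.Involutive swap := fun p => by
    ext i <;> by_cases hi : i ∈ S <;> simp [swap, hi]
  have hP' (f g : ∀ i, π i) : P (S.piecewise f g) = P f :=
    hP fun i hi => Set.piecewise_eq_of_mem _ _ _ hi
  have hQ' (f g : ∀ i, π i) : Q (S.piecewise g f) = Q f :=
    hQ fun i hi => Set.piecewise_eq_of_notMem _ _ _ (hST.notMem_of_mem_right hi)
  have hcard : #{f | P f ∧ Q f} * Fintype.card (∀ i, π i) = #{f | P f} * #{f | Q f} := by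
    rw [← card_univ, ← card_product, ← card_product]
    exact card_equiv hswap.toPerm fun p => by simp [swap, hP', hQ']
  obtain hempty | hnonempty := isEmpty_or_nonempty (∀ i, π i)
  · simp [dens]
  · have hpos : (Fintype.card (∀ i, π i) : ℚ≥0) ≠ 0 :=
      Nat.cast_ne_zero.2 Fintype.card_ne_zero
    rw [dens, dens, dens, div_mul_div_comm, div_eq_div_iff hpos (mul_ne_zero hpos hpos),
      ← mul_assoc]
    exact_mod_cast congrArg (· * Fintype.card (∀ i, π i)) hcard

theorem dens_filter_forall_of_dependsOn {C : Finset κ} {S : κ → Set ι}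
    (hS : (C : Set κ).PairwiseDisjoint S) {P : κ → (∀ i, π i) → Prop} [∀ c, DecidablePred (P c)]
    (hP : ∀ c ∈ C, DependsOn (P c) (S c)) [Nonempty (∀ i, π i)] :
    dens {f | ∀ c ∈ C, P c f} = ∏ c ∈ C, dens {f | P c f} := by
  classical
  induction C using Finset.induction_on with
  | empty => simp
  | insert c C hc ih =>
    rw [coe_insert] at hS
    have hrest : DependsOn (fun f => ∀ d ∈ C, P d f) (⋃ d ∈ C, S d) := fun f g hfg =>
      propext <| forall₂_congr fun d hd => (hP d (mem_insert_of_mem hd) fun i hi =>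
        hfg i (Set.mem_biUnion hd hi)).to_iff
    have hdisj : Disjoint (S c) (⋃ d ∈ C, S d) := Set.disjoint_iUnion₂_right.2 fun d hd =>
      hS (Set.mem_insert _ _) (Set.mem_insert_of_mem _ hd) (ne_of_mem_of_not_mem hd hc).symm
    rw [prod_insert hc, ← ih (hS.subset (Set.subset_insert _ _))
      fun d hd => hP d (mem_insert_of_mem hd),
      ← dens_filter_and_of_dependsOn hdisj (hP c (mem_insert_self c C)) hrest]
    simp only [forall_mem_insert]

theorem dens_filter_comp_of_surjective {G H : Type*} [Group G] [Group H] [Fintype G] [Fintype H]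
    (φ : G →* H) (hφ : Function.Surjective φ) (P : H → Prop) [DecidablePred P] :
    dens {g | P (φ g)} = dens {h | P h} := by
  classical
  have hcard (Q : H → Prop) [DecidablePred Q] :
      #{g | Q (φ g)} = #{h | Q h} * #{g | φ g = 1} := by
    rw [card_eq_sum_card_fiberwise (f := φ) (t := {h | Q h}) fun g hg => by simpa using hg,
      ← smul_eq_mul, ← sum_const]
    refine sum_congr rfl fun h hh => ?_
    rw [filter_filter, ← MonoidHom.card_fiber_eq_of_mem_range φ (hφ h) (hφ 1)]
    congr 1 with g
    simp only [mem_filter, mem_univ, true_and, and_iff_right_iff_imp] at hh ⊢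
    exact fun hg => hg ▸ hh
  have huniv : Fintype.card G = Fintype.card H * #{g | φ g = 1} := by
    simpa using hcard fun _ => True
  have hfiber : (#{g | φ g = 1} : ℚ≥0) ≠ 0 :=
    Nat.cast_ne_zero.2 (card_ne_zero_of_mem (mem_filter.2 ⟨mem_univ 1, map_one φ⟩))
  rw [dens, dens, hcard P, huniv, Nat.cast_mul, Nat.cast_mul, mul_div_mul_right _ _ hfiber]

theorem dens_filter_le_two_mul_of_involutive {X A : Type*} [Fintype X] [AddCommGroup A]
    [LinearOrder A] [IsOrderedAddMonoid A] {σ : X → X} (hσ : Function.Involutive σ)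
    {P : X → Prop} [DecidablePred P] (hP : ∀ x, P x → P (σ x)) {g : X → A}
    (hg : ∀ x, g (σ x) = -g x) :
    dens {x | P x} ≤ 2 * dens {x | P x ∧ g x ≤ 0} := by
  have hcard : #{x | P x ∧ ¬ g x ≤ 0} ≤ #{x | P x ∧ g x ≤ 0} := by
    refine card_le_card_of_injOn σ (fun x hx => ?_) hσ.injective.injOn
    simp only [coe_filter, mem_univ, true_and, Set.mem_ofPred_eq, not_le] at hx ⊢
    exact ⟨hP x hx.1, hg x ▸ neg_nonpos.2 hx.2.le⟩
  rw [← dens_filter_add_dens_filter_not_eq_dens fun x => g x ≤ 0, filter_filter, filter_filter,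
    two_mul]
  simp only [dens]
  gcongr

end Density

section LocalEvent

variable {n : ℕ}

theorem condPmf_eq_pow_mul_pow (δ : ℝ) (x y : Cube n) :
    condPmf (1 - 2 * δ) x y = (1 - δ) ^ (n - hammingDist y x) * δ ^ hammingDist y x := by
  have hδ : (1 - (1 - 2 * δ)) / 2 = δ := by ring
  have hsum := sum_pow_mul_pow_hammingDist (1 - δ) δ y
  simp only [Fintype.card_fin, Fintype.card_units_int, Nat.add_one_sub_one, Nat.cast_one, one_mul,
    sub_add_cancel, one_pow] at hsum
  simp only [condPmf, marginalPmf, jointPmf, hδ, prod_ite_eq_pow_mul_pow_hammingDist,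
    Fintype.card_fin, ← mul_sum, hsum, mul_one]
  exact mul_div_cancel_left₀ _ (by positivity)

theorem condPmf_nonneg {δ : ℝ} (h0 : 0 ≤ δ) (h1 : δ ≤ 1) (x y : Cube n) :
    0 ≤ condPmf (1 - 2 * δ) x y := by
  rw [condPmf_eq_pow_mul_pow]
  exact mul_nonneg (pow_nonneg (sub_nonneg.2 h1) _) (pow_nonneg h0 _)

theorem sum_condPmf_compl_hammingBall_le {δ : ℝ} (h0 : 0 ≤ δ) (h1 : δ ≤ 1) (K : ℕ)
    (y : Cube n) :
    ∑ x ∈ (hammingBall y K)ᶜ, condPmf (1 - 2 * δ) x y ≤ Real.exp (n * δ) / 2 ^ K := by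
  rw [le_div_iff₀' (by positivity)]
  simp only [condPmf_eq_pow_mul_pow]
  calc _ ≤ (1 - δ + 2 * δ) ^ n := by
        simpa using pow_mul_sum_compl_hammingBall_le (sub_nonneg.2 h1) h0 one_le_two K y
    _ = (δ + 1) ^ n := by ring
    _ ≤ Real.exp δ ^ n := by gcongr; exact Real.add_one_le_exp δ
    _ = Real.exp (n * δ) := (Real.exp_nat_mul δ n).symm

/-- The contribution of the points of `s` to the correlation `f y * T_ρ f y`. The function `f` is
self-predicting at `y` only if the total over the whole cube is nonnegative. -/
noncomputable def partialCorr (ρ : ℝ) (f : BoolFun n) (y : Cube n) (s : Finset (Cube n)) : ℝ :=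
  ∑ x ∈ s, condPmf ρ x y * (((f y * f x : ℤˣ) : ℤ) : ℝ)

theorem partialCorr_univ (ρ : ℝ) (f : BoolFun n) (y : Cube n) :
    partialCorr ρ f y univ = (f y : ℤ) * noiseOp ρ f y := by
  simp only [partialCorr, noiseOp, mul_sum, Units.val_mul, Int.cast_mul, mul_left_comm]

theorem abs_partialCorr_le {δ : ℝ} (h0 : 0 ≤ δ) (h1 : δ ≤ 1) (f : BoolFun n) (y : Cube n)
    (s : Finset (Cube n)) :
    |partialCorr (1 - 2 * δ) f y s| ≤ ∑ x ∈ s, condPmf (1 - 2 * δ) x y := by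
  refine (abs_sum_le_sum_abs _ _).trans_eq (sum_congr rfl fun x _ => ?_)
  rw [abs_mul, abs_of_nonneg (condPmf_nonneg h0 h1 x y), ← Int.cast_abs, Int.isUnit_iff_abs_eq.1
    (Units.isUnit _), Int.cast_one, mul_one]

theorem IsSPAt.partialCorr_univ_nonneg {ρ : ℝ} {f : BoolFun n} {y : Cube n} (h : IsSPAt ρ f y) :
    0 ≤ partialCorr ρ f y univ := by
  rw [partialCorr_univ]
  by_cases h0 : noiseOp ρ f y = 0
  · rw [h0, mul_zero]
  · rw [h h0]
    exact Real.sign_mul_nonneg _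

/-- A relaxation of `IsSPAt (1 - 2 * δ) f y` that involves only the values of `f` within distance
`K` of `y`: the slack bounds the contribution of all other points. -/
def IsNearlySPAt (δ : ℝ) (K : ℕ) (f : BoolFun n) (y : Cube n) : Prop :=
  -(Real.exp (n * δ) / 2 ^ K) ≤ partialCorr (1 - 2 * δ) f y (hammingBall y K)

theorem IsSPAt.isNearlySPAt {δ : ℝ} (h0 : 0 ≤ δ) (h1 : δ ≤ 1) {f : BoolFun n} {y : Cube n}
    (h : IsSPAt (1 - 2 * δ) f y) (K : ℕ) : IsNearlySPAt δ K f y := by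
  have hnonneg := h.partialCorr_univ_nonneg
  rw [partialCorr, ← sum_add_sum_compl (hammingBall y K)] at hnonneg
  have htail := (le_abs_self _).trans ((abs_partialCorr_le h0 h1 f y (hammingBall y K)ᶜ).trans
    (sum_condPmf_compl_hammingBall_le h0 h1 K y))
  exact neg_le_iff_add_nonneg.2 (hnonneg.trans (add_le_add_right htail _))

theorem dependsOn_isNearlySPAt (δ : ℝ) (K : ℕ) (y : Cube n) :
    DependsOn (fun f : BoolFun n => IsNearlySPAt δ K f y) (hammingBall y K : Set (Cube n)) := by
  intro f g hfg
  have hy : f y = g y := hfg y (by simp [mem_hammingBall])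
  have hcorr : partialCorr (1 - 2 * δ) f y (hammingBall y K) =
      partialCorr (1 - 2 * δ) g y (hammingBall y K) :=
    sum_congr rfl fun x hx => by rw [hy, hfg x hx]
  simp only [IsNearlySPAt, hcorr]

/-- The neighbour of `y` in direction `i`. -/
def flipAt (y : Cube n) (i : Fin n) : Cube n := Function.update y i (-y i)

theorem ne_flipAt_apply_iff {y : Cube n} {i k : Fin n} : y k ≠ flipAt y i k ↔ k = i := by
  obtain rfl | h := eq_or_ne k i
  · simp [flipAt, units_ne_neg_self]
  · simp [flipAt, h]

theorem hammingDist_flipAt (y : Cube n) (i : Fin n) : hammingDist y (flipAt y i) = 1 := by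
  simp [hammingDist, ne_flipAt_apply_iff, filter_eq']

theorem flipAt_ne_self (y : Cube n) (i : Fin n) : flipAt y i ≠ y :=
  (hammingDist_pos.1 (hammingDist_flipAt y i ▸ one_pos)).symm

theorem flipAt_injective (y : Cube n) : Function.Injective (flipAt y) := fun i _ h =>
  ne_flipAt_apply_iff.1 (h ▸ ne_flipAt_apply_iff.2 (Eq.refl i))

/-- The point `y` together with its `n` neighbours. -/
def closedNeighbors (y : Cube n) : Finset (Cube n) := insert y (univ.image (flipAt y))

theorem self_mem_closedNeighbors (y : Cube n) : y ∈ closedNeighbors y := mem_insert_self _ _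

theorem flipAt_mem_closedNeighbors (y : Cube n) (i : Fin n) : flipAt y i ∈ closedNeighbors y :=
  mem_insert_of_mem (mem_image_of_mem _ (mem_univ i))

theorem closedNeighbors_subset_hammingBall (y : Cube n) {K : ℕ} (hK : 1 ≤ K) :
    closedNeighbors y ⊆ hammingBall y K := by
  simp [closedNeighbors, insert_subset_iff, image_subset_iff, mem_hammingBall, hammingDist_flipAt,
    hK]

theorem sum_closedNeighbors {M : Type*} [AddCommMonoid M] (y : Cube n) (g : Cube n → M) :
    ∑ x ∈ closedNeighbors y, g x = g y + ∑ i, g (flipAt y i) := by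
  rw [closedNeighbors, sum_insert (by simp [flipAt_ne_self]),
    sum_image (flipAt_injective y).injOn]

/-- The vector of signs recording with which of its neighbours `y` agrees under `f`. Being a
surjective homomorphism in `f`, it is uniformly distributed when `f` is. -/
def agreement (y : Cube n) : BoolFun n →* Cube n where
  toFun f i := f y * f (flipAt y i)
  map_one' := by ext; simp
  map_mul' _ _ := funext fun _ => mul_mul_mul_comm _ _ _ _

theorem agreement_apply (y : Cube n) (f : BoolFun n) (i : Fin n) :
    agreement y f i = f y * f (flipAt y i) := rfl

theorem agreement_surjective (y : Cube n) : Function.Surjective (agreement y) := by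
  intro v
  refine ⟨Function.extend (flipAt y) v 1, funext fun i => ?_⟩
  rw [agreement_apply, (flipAt_injective y).extend_apply, Function.extend_apply', Pi.one_apply,
    one_mul]
  exact fun ⟨k, hk⟩ => flipAt_ne_self y k hk

theorem dens_filter_hammingDist_agreement (u y : Cube n) (j : ℕ) :
    dens {f | hammingDist u (agreement y f) = j} = n.choose j / 2 ^ n := by
  rw [dens_filter_comp_of_surjective (agreement y) (agreement_surjective y)
    (fun v => hammingDist u v = j), dens, card_filter_hammingDist_eq]
  simp

theorem sum_coe_units_eq {ι : Type*} [Fintype ι] (v : ι → ℤˣ) :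
    ∑ i, ((v i : ℤ) : ℝ) = 2 * hammingDist (-1) v - Fintype.card ι := by
  have hcoe (i : ι) : ((v i : ℤ) : ℝ) = 2 * (if (-1 : ι → ℤˣ) i ≠ v i then 1 else 0) - 1 := by
    obtain h | h := Int.units_eq_one_or (v i) <;> norm_num [h]
  simp only [hcoe, sum_sub_distrib, ← mul_sum, sum_boole, sum_const, card_univ, nsmul_eq_mul,
    mul_one]
  rfl

theorem partialCorr_closedNeighbors (δ : ℝ) (f : BoolFun n) (y : Cube n) :
    partialCorr (1 - 2 * δ) f y (closedNeighbors y) =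
      (1 - δ) ^ n + (1 - δ) ^ (n - 1) * (δ * (2 * hammingDist (-1) (agreement y f) - n)) := by
  rw [partialCorr, sum_closedNeighbors, ← mul_assoc]
  have hneighbors := sum_coe_units_eq (agreement y f)
  rw [Fintype.card_fin] at hneighbors
  rw [← hneighbors, mul_sum]
  simp [condPmf_eq_pow_mul_pow, hammingDist_flipAt, agreement_apply]

theorem dens_filter_hammingDist_agreement_le_two_mul (ρ : ℝ) (y : Cube n)
    (s : Finset (Cube n)) (j : ℕ) (hs : Disjoint s (closedNeighbors y)) :
    dens {f | hammingDist (-1) (agreement y f) = j} ≤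
      2 * dens {f | hammingDist (-1) (agreement y f) = j ∧ partialCorr ρ f y s ≤ 0} := by
  let σ : BoolFun n → BoolFun n := fun f => (closedNeighbors y).piecewise f (-f)
  have hfix (f) {x} (hx : x ∈ closedNeighbors y) : σ f x = f x := piecewise_eq_of_mem _ _ _ hx
  have hneg (f) {x} (hx : x ∉ closedNeighbors y) : σ f x = -f x := piecewise_eq_of_notMem _ _ _ hx
  refine dens_filter_le_two_mul_of_involutive (σ := σ) (fun f => funext fun x => ?_)
    (fun f hf => ?_) (fun f => ?_)
  · by_cases hx : x ∈ closedNeighbors y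
    · rw [hfix _ hx, hfix _ hx]
    · rw [hneg _ hx, hneg _ hx, neg_neg]
  · convert hf using 2
    ext1 i
    rw [agreement_apply, agreement_apply, hfix f (self_mem_closedNeighbors y),
      hfix f (flipAt_mem_closedNeighbors y i)]
  · rw [partialCorr, partialCorr, ← sum_neg_distrib]
    refine sum_congr rfl fun x hx => ?_
    rw [hfix f (self_mem_closedNeighbors y), hneg f (disjoint_left.1 hs hx)]
    simp

theorem not_isNearlySPAt {δ η : ℝ} (h0 : 0 ≤ δ) (h1 : δ ≤ 1) {K : ℕ} (hK : 1 ≤ K)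
    (hη : Real.exp (n * δ) / 2 ^ K < η * (1 - δ) ^ n) {f : BoolFun n} {y : Cube n}
    (hagree : δ * (2 * hammingDist (-1) (agreement y f) - n) ≤ -(1 + η))
    (hfar : partialCorr (1 - 2 * δ) f y (hammingBall y K \ closedNeighbors y) ≤ 0) :
    ¬ IsNearlySPAt δ K f y := by
  have hδ : 0 ≤ 1 - δ := sub_nonneg.2 h1
  have hη0 : 0 < η := pos_of_mul_pos_left ((by positivity : (0 : ℝ) < _).trans hη) (by positivity)
  have hpow : (1 - δ) ^ n ≤ (1 - δ) ^ (n - 1) :=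
    pow_le_pow_of_le_one hδ (by linarith) (Nat.sub_le n 1)
  have hneighbors : partialCorr (1 - 2 * δ) f y (closedNeighbors y) ≤ -(η * (1 - δ) ^ n) := by
    rw [partialCorr_closedNeighbors]
    calc _ ≤ (1 - δ) ^ n + (1 - δ) ^ n * -(1 + η) := by
          gcongr (1 - δ) ^ n + ?_
          exact (mul_le_mul_of_nonpos_right hpow (by linarith)).trans
            (mul_le_mul_of_nonneg_left hagree (by positivity))
      _ = -(η * (1 - δ) ^ n) := by ring
  rw [IsNearlySPAt, not_le]
  calc partialCorr (1 - 2 * δ) f y (hammingBall y K)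
      = partialCorr (1 - 2 * δ) f y (hammingBall y K \ closedNeighbors y) +
          partialCorr (1 - 2 * δ) f y (closedNeighbors y) :=
        (sum_sdiff (closedNeighbors_subset_hammingBall y hK)).symm
    _ < -(Real.exp (n * δ) / 2 ^ K) := by linarith

open Classical in
theorem dens_isNearlySPAt_le {δ η : ℝ} (h0 : 0 ≤ δ) (h1 : δ ≤ 1) {K : ℕ} (hK : 1 ≤ K)
    (hη : Real.exp (n * δ) / 2 ^ K < η * (1 - δ) ^ n) {j : ℕ}
    (hj : δ * (2 * j - n) ≤ -(1 + η)) (y : Cube n) :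
    (dens {f : BoolFun n | IsNearlySPAt δ K f y} : ℝ) ≤ 1 - n.choose j / (2 * 2 ^ n) := by
  have hhalf : dens {f : BoolFun n | hammingDist (-1) (agreement y f) = j} ≤
      2 * dens {f : BoolFun n | ¬ IsNearlySPAt δ K f y} := by
    refine (dens_filter_hammingDist_agreement_le_two_mul (1 - 2 * δ) y
      (hammingBall y K \ closedNeighbors y) j sdiff_disjoint).trans ?_
    gcongr with f
    rintro ⟨rfl, hfar⟩
    exact not_isNearlySPAt h0 h1 hK hη hj hfar
  rw [dens_filter_hammingDist_agreement] at hhalf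
  have hhalf' : (n.choose j : ℝ) / 2 ^ n ≤
      2 * (dens {f : BoolFun n | ¬ IsNearlySPAt δ K f y} : ℝ) := by
    simpa using (NNRat.cast_le (K := ℝ)).2 hhalf
  have htotal : (dens {f : BoolFun n | IsNearlySPAt δ K f y} : ℝ) +
      (dens {f : BoolFun n | ¬ IsNearlySPAt δ K f y} : ℝ) = 1 := by
    exact_mod_cast (dens_filter_add_dens_filter_not_eq_dens _).trans dens_univ
  rw [mul_comm, ← div_div]
  linarith

end LocalEvent

section Fraction

variable {n : ℕ}

open Classical in
theorem fractionSP_eq_dens (ρ : ℝ) :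
    fractionSP n ρ = (dens {f : BoolFun n | IsSP ρ f} : ℝ) := by
  rw [nnratCast_dens, fractionSP, Nat.card_eq_fintype_card, Nat.card_eq_fintype_card,
    Fintype.card_subtype]

open Classical in
theorem fractionSP_le_pow_card {δ : ℝ} (h0 : 0 ≤ δ) (h1 : δ ≤ 1) {K : ℕ} {C : Finset (Cube n)}
    (hC : (C : Set (Cube n)).Pairwise fun x y => 2 * K < hammingDist x y) {q : ℝ}
    (hq : ∀ y, (dens {f : BoolFun n | IsNearlySPAt δ K f y} : ℝ) ≤ q) :
    fractionSP n (1 - 2 * δ) ≤ q ^ #C := by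
  have hdisj : (C : Set (Cube n)).PairwiseDisjoint
      fun y => (hammingBall y K : Set (Cube n)) := fun x hx y hy hxy =>
    disjoint_coe.2 (disjoint_hammingBall (hC hx hy hxy))
  calc fractionSP n (1 - 2 * δ)
      ≤ (dens {f : BoolFun n | ∀ y ∈ C, IsNearlySPAt δ K f y} : ℝ) := by
        rw [fractionSP_eq_dens]
        gcongr with f
        exact fun hf y _ => (hf y).isNearlySPAt h0 h1 K
    _ = ∏ y ∈ C, (dens {f : BoolFun n | IsNearlySPAt δ K f y} : ℝ) := by
        rw [← NNRat.cast_prod, ← dens_filter_forall_of_dependsOn hdisj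
          (P := fun y f => IsNearlySPAt δ K f y) fun y _ => dependsOn_isNearlySPAt δ K y]
        congr!
    _ ≤ ∏ _y ∈ C, q := prod_le_prod (fun _ _ => NNRat.cast_nonneg _) fun y _ => hq y
    _ = q ^ #C := prod_const q

theorem fractionSP_le_exp_neg_choose {δ η : ℝ} (hn : n ≠ 0) (h0 : 0 ≤ δ) (h1 : δ ≤ 1) {K : ℕ}
    (hK : 1 ≤ K) (hη : Real.exp (n * δ) / 2 ^ K < η * (1 - δ) ^ n) {j : ℕ}
    (hj : δ * (2 * j - n) ≤ -(1 + η)) :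
    fractionSP n (1 - 2 * δ) ≤
      Real.exp (-(n.choose j / (2 * Real.exp 1 * n ^ (2 * K)))) := by
  classical
  have : NeZero n := ⟨hn⟩
  obtain ⟨C, hsep, hlarge⟩ := exists_pairwise_lt_hammingDist_card_le (ι := Fin n) (β := ℤˣ) (2 * K)
  simp only [Fintype.card_fin, Fintype.card_units_int, Nat.cast_ofNat, Nat.add_one_sub_one,
    Nat.cast_one] at hlarge
  set p : ℝ := n.choose j / (2 * 2 ^ n) with hp
  have hdens := dens_isNearlySPAt_le h0 h1 hK hη hj
  have hp1 : 0 ≤ 1 - p := (NNRat.cast_nonneg _).trans (hdens 1)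
  calc fractionSP n (1 - 2 * δ) ≤ (1 - p) ^ #C := fractionSP_le_pow_card h0 h1 hsep hdens
    _ ≤ Real.exp (-p) ^ #C := by gcongr; exact Real.one_sub_le_exp_neg p
    _ = Real.exp (-(#C * p)) := by rw [← Real.exp_nat_mul, mul_neg]
    _ ≤ Real.exp (-(n.choose j / (2 * Real.exp 1 * n ^ (2 * K)))) := by
      gcongr
      rw [hp, mul_div_assoc', div_le_div_iff₀ (by positivity) (by positivity)]
      calc (n.choose j : ℝ) * (2 * 2 ^ n)
          ≤ n.choose j * (2 * (#C * (Real.exp 1 * n ^ (2 * K)))) := by gcongr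
        _ = #C * n.choose j * (2 * Real.exp 1 * n ^ (2 * K)) := by ring

theorem exp_neg_two_mul_le_one_sub {x : ℝ} (h0 : 0 ≤ x) (h1 : x ≤ 1 / 2) :
    Real.exp (-(2 * x)) ≤ 1 - x := by
  rw [Real.exp_neg]
  refine inv_le_of_inv_le₀ (by linarith) (le_trans ?_ (Real.add_one_le_exp (2 * x)))
  rw [inv_le_iff_one_le_mul₀ (by linarith)]
  nlinarith

theorem fractionSP_one_sub_two_mul_div_le {α η : ℝ} (hα : 0 < α) (hn : 2 * α ≤ n) {K : ℕ}
    (hK : 1 ≤ K) (hη : Real.exp α / 2 ^ K < η * Real.exp (-(2 * α))) {j : ℕ}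
    (hj : 2 * α * j ≤ n * (α - 1 - η)) :
    fractionSP n (1 - 2 * α / n) ≤ Real.exp (-(n.choose j / (2 * Real.exp 1 * n ^ (2 * K)))) := by
  have hn0 : (0 : ℝ) < n := by linarith
  have hnα : n * (α / n) = α := mul_div_cancel₀ α hn0.ne'
  have hδ0 : 0 ≤ α / n := by positivity
  have hδ1 : α / n ≤ 1 / 2 := by
    rw [div_le_div_iff₀ hn0 two_pos]
    linarith
  have hη0 : 0 < η := pos_of_mul_pos_left ((by positivity : (0 : ℝ) < _).trans hη) (by positivity)
  have hpow : Real.exp (-(2 * α)) ≤ (1 - α / n) ^ n := by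
    calc Real.exp (-(2 * α)) = Real.exp (-(2 * (α / n))) ^ n := by
          rw [← Real.exp_nat_mul, mul_neg, mul_left_comm, hnα]
      _ ≤ (1 - α / n) ^ n := by gcongr; exact exp_neg_two_mul_le_one_sub hδ0 hδ1
  rw [mul_div_assoc]
  refine fractionSP_le_exp_neg_choose (Nat.cast_pos.1 hn0).ne' hδ0 (by linarith) hK
    (η := η) ?_ ?_
  · rw [hnα]
    exact hη.trans_le (mul_le_mul_of_nonneg_left hpow hη0.le)
  · rw [div_mul_eq_mul_div, div_le_iff₀ hn0]
    linarith

end Fraction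

section Entropy

theorem log_factorial_le (n : ℕ) :
    Real.log n.factorial ≤ n * Real.log n - n + Real.log n / 2 + 1 := by
  obtain _ | m := n
  · simp
  have hanti := Stirling.log_stirlingSeq'_antitone (Nat.zero_le m)
  simp only [Function.comp, Nat.succ_eq_add_one, zero_add] at hanti
  have hpos : (0 : ℝ) < ((m + 1 : ℕ) : ℝ) := by positivity
  rw [Stirling.log_stirlingSeq_formula, Stirling.stirlingSeq_one,
    Real.log_div (Real.exp_pos 1).ne' (by positivity), Real.log_exp,
    Real.log_sqrt zero_le_two, Real.log_mul two_ne_zero hpos.ne',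
    Real.log_div hpos.ne' (Real.exp_pos 1).ne', Real.log_exp] at hanti
  linarith

theorem le_log_factorial (n : ℕ) : n * Real.log n - n ≤ Real.log n.factorial := by
  obtain rfl | hn := eq_or_ne n 0
  · simp
  have hstirling := Stirling.le_log_factorial_stirling hn
  have hlog : 0 ≤ Real.log n := Real.log_natCast_nonneg n
  have hlogpi : 0 ≤ Real.log (2 * Real.pi) := Real.log_nonneg (by linarith [Real.pi_gt_three])
  linarith

theorem add_mul_binEntropy_div_add {a b : ℝ} (h : a + b ≠ 0) :
    (a + b) * Real.binEntropy (a / (a + b)) =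
      (a + b) * Real.log (a + b) - a * Real.log a - b * Real.log b := by
  have hscale (x : ℝ) : (a + b) * Real.negMulLog (x / (a + b)) =
      x * Real.log (a + b) - x * Real.log x := by
    have hmul := Real.negMulLog_mul (x / (a + b)) (a + b)
    rw [div_mul_cancel₀ x h] at hmul
    calc (a + b) * Real.negMulLog (x / (a + b))
        = Real.negMulLog x - x / (a + b) * Real.negMulLog (a + b) := by linarith
      _ = x * Real.log (a + b) - x * Real.log x := by
        rw [Real.negMulLog, Real.negMulLog]
        field_simp
        ring
  rw [Real.binEntropy_eq_negMulLog_add_negMulLog_one_sub, one_sub_div h, add_sub_cancel_left,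
    mul_add, hscale, hscale]
  ring

theorem mul_binEntropy_div_sub_le_log_choose {n j : ℕ} (hj : j ≤ n) :
    n * Real.binEntropy (j / n) - Real.log n - 2 ≤ Real.log (n.choose j) := by
  obtain rfl | hn := eq_or_ne n 0
  · obtain rfl := Nat.le_zero.1 hj
    simp
  have hlog {k : ℕ} (hk : k ≤ n) : Real.log k ≤ Real.log n := by
    obtain rfl | hk0 := eq_or_ne k 0
    · simpa using Real.log_natCast_nonneg n
    · exact Real.log_le_log (by positivity) (Nat.cast_le.2 hk)
  have hchoose : Real.log (n.choose j) =
      Real.log n.factorial - Real.log j.factorial - Real.log (n - j).factorial := by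
    rw [Nat.cast_choose ℝ hj, Real.log_div (by positivity) (by positivity),
      Real.log_mul (by positivity) (by positivity), sub_sub]
  have hentropy := add_mul_binEntropy_div_add (a := j) (b := (n - j : ℕ)) (by
    rw [← Nat.cast_add, Nat.add_sub_of_le hj]
    exact_mod_cast hn)
  rw [← Nat.cast_add, Nat.add_sub_of_le hj] at hentropy
  have hcast : (n : ℝ) = j + (n - j : ℕ) := by rw [← Nat.cast_add, Nat.add_sub_of_le hj]
  linarith [le_log_factorial n, log_factorial_le j, log_factorial_le (n - j), hlog hj,
    hlog (Nat.sub_le n j)]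

theorem eventually_exp_mul_le_choose_floor {t h : ℝ} (ht0 : 0 ≤ t) (ht1 : t ≤ 1)
    (hlt : h < Real.binEntropy t) :
    ∀ᶠ n : ℕ in atTop, Real.exp (n * h) ≤ n.choose ⌊t * n⌋₊ := by
  have hentropy : Tendsto (fun n : ℕ => Real.binEntropy ((⌊t * n⌋₊ : ℝ) / n)) atTop
      (nhds (Real.binEntropy t)) :=
    (Real.binEntropy_continuous.tendsto t).comp
      ((tendsto_nat_floor_mul_div_atTop ht0).comp tendsto_natCast_atTop_atTop)
  have hlog : Tendsto (fun n : ℕ => Real.log n / n) atTop (nhds 0) :=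
    Real.isLittleO_log_id_atTop.tendsto_div_nhds_zero.comp tendsto_natCast_atTop_atTop
  have hlim := (hentropy.sub hlog).sub (tendsto_const_div_atTop_nhds_zero_nat 2)
  rw [sub_zero, sub_zero] at hlim
  filter_upwards [hlim.eventually_const_lt hlt, eventually_gt_atTop 0] with n hn hn0
  have hn0' : (0 : ℝ) < n := Nat.cast_pos.2 hn0
  have hj : ⌊t * n⌋₊ ≤ n := Nat.floor_le_of_le (mul_le_of_le_one_left hn0'.le ht1)
  rw [← Real.le_log_iff_exp_le (Nat.cast_pos.2 (Nat.choose_pos hj))]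
  refine le_trans ?_ (mul_binEntropy_div_sub_le_log_choose hj)
  calc n * h ≤ n * (Real.binEntropy ((⌊t * n⌋₊ : ℝ) / n) - Real.log n / n - 2 / n) := by gcongr
    _ = _ := by field_simp

theorem eventually_mul_pow_le_exp (c : ℝ) (m : ℕ) {ε : ℝ} (hε : 0 < ε) :
    ∀ᶠ n : ℕ in atTop, c * n ^ m ≤ Real.exp (n * ε) := by
  have hlittle := ((isLittleO_pow_exp_pos_mul_atTop m hε).comp_tendsto
    tendsto_natCast_atTop_atTop).const_mul_left c
  filter_upwards [hlittle.bound one_pos] with n hn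
  simpa [mul_comm ε] using (le_abs_self _).trans hn

theorem binEnt_eq_div_log_two (t : ℝ) : binEnt t = Real.binEntropy t / Real.log 2 := by
  rw [binEnt, Real.binEntropy_eq_negMulLog_add_negMulLog_one_sub, Real.negMulLog, Real.negMulLog,
    Real.logb, Real.logb]
  ring

theorem continuous_binEnt : Continuous binEnt := by
  simp only [funext binEnt_eq_div_log_two]
  fun_prop

theorem eventually_two_rpow_le_choose_floor_div {t h : ℝ} (ht0 : 0 ≤ t) (ht1 : t ≤ 1)
    (hlt : h < binEnt t) {c : ℝ} (hc : 0 < c) (m : ℕ) :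
    ∀ᶠ n : ℕ in atTop, (2 : ℝ) ^ (n * h) ≤ n.choose ⌊t * n⌋₊ / (c * n ^ m) := by
  have hlt' : h * Real.log 2 < Real.binEntropy t := by
    rwa [binEnt_eq_div_log_two, lt_div_iff₀ (Real.log_pos one_lt_two)] at hlt
  obtain ⟨s, hs, hst⟩ := exists_between hlt'
  filter_upwards [eventually_exp_mul_le_choose_floor ht0 ht1 hst,
    eventually_mul_pow_le_exp c m (sub_pos.2 hs), eventually_gt_atTop 0] with n hchoose hpoly hn
  rw [le_div_iff₀ (by positivity)]
  calc (2 : ℝ) ^ (n * h) * (c * n ^ m)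
      ≤ Real.exp (n * (h * Real.log 2)) * Real.exp (n * (s - h * Real.log 2)) := by
        rw [Real.rpow_def_of_pos two_pos, mul_comm (Real.log 2), mul_assoc]
        gcongr
    _ = Real.exp (n * s) := by rw [← Real.exp_add, ← mul_add, add_sub_cancel]
    _ ≤ n.choose ⌊t * n⌋₊ := hchoose

end Entropy

section ErrorTerm

/-- The error term is the supremum of the admissible nonpositive values, lowered by one to stay
clear of the question whether the supremum is attained. -/
theorem exists_isLittleO_of_forall_eventually {ι : Type*} {l : Filter ι} {g : ι → ℝ}
    (hg : Tendsto g l atTop) {Q : ι → ℝ → Prop} (hanti : ∀ i, Antitone (Q i))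
    (hex : ∀ i, ∃ s, Q i s) (hev : ∀ ε > 0, ∀ᶠ i in l, Q i (-(ε * g i))) :
    ∃ r : ι → ℝ, r =o[l] g ∧ ∀ i, Q i (r i) := by
  let S (i : ι) : Set ℝ := {s | s ≤ 0 ∧ Q i s}
  have hbdd (i : ι) : BddAbove (S i) := ⟨0, fun _ hs => hs.1⟩
  have hne (i : ι) : (S i).Nonempty := by
    obtain ⟨s, hs⟩ := hex i
    exact ⟨min s 0, min_le_right s 0, hanti i (min_le_left s 0) hs⟩
  refine ⟨fun i => sSup (S i) - 1, IsLittleO.sub ?_ ?_, fun i => ?_⟩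
  · refine isLittleO_iff.2 fun ε hε => ?_
    filter_upwards [hev ε hε, hg.eventually_ge_atTop 0] with i hi hgi
    have hle : sSup (S i) ≤ 0 := csSup_le (hne i) fun _ hs => hs.1
    have hge : -(ε * g i) ≤ sSup (S i) :=
      le_csSup (hbdd i) ⟨neg_nonpos.2 (mul_nonneg hε.le hgi), hi⟩
    rw [Real.norm_of_nonpos hle, Real.norm_of_nonneg hgi]
    exact neg_le.1 hge
  · exact isLittleO_const_left.2 (Or.inr (tendsto_norm_atTop_atTop.comp hg))
  · obtain ⟨s, hs, hlt⟩ := exists_lt_of_lt_csSup (hne i) (sub_one_lt (sSup (S i)))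
    exact hanti i hlt.le hs.2

theorem antitone_le_exp_neg_two_rpow (x c : ℝ) :
    Antitone fun s : ℝ => x ≤ Real.exp (-(2 : ℝ) ^ (c + s)) := fun s t hst ht => by
  refine ht.trans ?_
  gcongr
  exact one_le_two

theorem exists_le_exp_neg_two_rpow {x : ℝ} (hx : x < 1) (c : ℝ) :
    ∃ s : ℝ, x ≤ Real.exp (-(2 : ℝ) ^ (c + s)) := by
  have hlim : Tendsto (fun s : ℝ => Real.exp (-(2 : ℝ) ^ (c + s))) atBot (nhds 1) := by
    have := (tendsto_rpow_atBot_of_base_gt_one 2 one_lt_two).comp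
      (tendsto_atBot_add_const_left atBot c tendsto_id)
    simpa [Function.comp_def] using (Real.continuous_exp.tendsto _).comp this.neg
  exact (hlim.eventually_const_le hx).exists

end ErrorTerm

section Asymptotics

theorem exists_one_le_and_div_two_pow_lt (a : ℝ) {b : ℝ} (hb : 0 < b) :
    ∃ K : ℕ, 1 ≤ K ∧ a / 2 ^ K < b := by
  have hlim : Tendsto (fun K : ℕ => a / (2 : ℝ) ^ K) atTop (nhds 0) :=
    tendsto_const_nhds.div_atTop (tendsto_pow_atTop_atTop_of_one_lt one_lt_two)
  exact ((eventually_ge_atTop 1).and (hlim.eventually_lt_const hb)).exists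

theorem fractionSP_lt_one {α : ℝ} (hα : 1 < α) {n : ℕ} (hn : 2 * α ≤ n) :
    fractionSP n (1 - 2 * α / n) < 1 := by
  have hη : 0 < α - 1 := sub_pos.2 hα
  have hn0 : (0 : ℝ) < n := by linarith
  obtain ⟨K, hK, hKη⟩ := exists_one_le_and_div_two_pow_lt (Real.exp α)
    (mul_pos hη (Real.exp_pos (-(2 * α))))
  refine (fractionSP_one_sub_two_mul_div_le (j := 0) (by linarith) hn hK hKη (by simp)).trans_lt ?_
  rw [Nat.choose_zero_right, Real.exp_lt_one_iff, neg_lt_zero]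
  positivity

theorem eventually_fractionSP_le {α : ℝ} (hα : 1 < α) {ε : ℝ} (hε : 0 < ε) :
    ∀ᶠ n : ℕ in atTop, fractionSP n (1 - 2 * α / n) ≤
      Real.exp (-(2 : ℝ) ^ (n * (binEnt ((α - 1) / (2 * α)) - ε))) := by
  have hα0 : 0 < 2 * α := by linarith
  have hcont : Continuous fun η : ℝ => binEnt ((α - 1 - η) / (2 * α)) :=
    continuous_binEnt.comp (by fun_prop)
  have hnear : ∀ᶠ η in nhdsWithin (0 : ℝ) (Set.Ioi 0),
      binEnt ((α - 1) / (2 * α)) - ε < binEnt ((α - 1 - η) / (2 * α)) :=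
    nhdsWithin_le_nhds ((hcont.tendsto 0).eventually_const_lt (by simpa using hε))
  obtain ⟨η, hη, hη0, hη1⟩ := (hnear.and (Ioo_mem_nhdsGT (sub_pos.2 hα))).exists
  obtain ⟨K, hK, hKη⟩ := exists_one_le_and_div_two_pow_lt (Real.exp α)
    (mul_pos hη0 (Real.exp_pos (-(2 * α))))
  set t : ℝ := (α - 1 - η) / (2 * α) with ht
  have ht0 : 0 ≤ t := div_nonneg (by linarith) hα0.le
  have ht1 : t ≤ 1 := (div_le_one hα0).2 (by linarith)
  filter_upwards [eventually_two_rpow_le_choose_floor_div ht0 ht1 hη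
      (c := 2 * Real.exp 1) (by positivity) (2 * K),
    tendsto_natCast_atTop_atTop.eventually_ge_atTop (2 * α)] with n hchoose hn
  refine (fractionSP_one_sub_two_mul_div_le (by linarith) hn hK hKη ?_).trans
    (Real.exp_le_exp.2 (neg_le_neg hchoose))
  calc 2 * α * (⌊t * n⌋₊ : ℝ) ≤ 2 * α * (t * n) := by
        gcongr
        exact Nat.floor_le (by positivity)
    _ = n * (α - 1 - η) := by
        rw [ht]
        field_simp

end Asymptotics

end SelfPredicting

theorem mainTheorem1 (α : ℝ) (hα : 1 < α) :
    ∃ r : ℕ → ℝ, r =o[atTop] (fun n : ℕ => (n : ℝ)) ∧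
      ∀ n : ℕ, 2 * α ≤ (n : ℝ) →
        SelfPredicting.fractionSP n (1 - 2 * α / (n : ℝ)) ≤
          Real.exp (-(2 : ℝ) ^ ((n : ℝ) * SelfPredicting.binEnt ((α - 1) / (2 * α)) + r n)) := by
  refine SelfPredicting.exists_isLittleO_of_forall_eventually tendsto_natCast_atTop_atTop
    (Q := fun n s => 2 * α ≤ (n : ℝ) → SelfPredicting.fractionSP n (1 - 2 * α / n) ≤
      Real.exp (-(2 : ℝ) ^ (n * SelfPredicting.binEnt ((α - 1) / (2 * α)) + s)))
    (fun n _ _ hst ht hn => SelfPredicting.antitone_le_exp_neg_two_rpow _ _ hst (ht hn))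
    (fun n => ?_) (fun ε hε => ?_)
  · by_cases hn : 2 * α ≤ n
    · obtain ⟨s, hs⟩ := SelfPredicting.exists_le_exp_neg_two_rpow
        (SelfPredicting.fractionSP_lt_one hα hn) (n * SelfPredicting.binEnt ((α - 1) / (2 * α)))
      exact ⟨s, fun _ => hs⟩
    · exact ⟨0, fun h => absurd h hn⟩
  · filter_upwards [SelfPredicting.eventually_fractionSP_le hα hε] with n hbound _
    rwa [mul_comm ε, ← sub_eq_add_neg, ← mul_sub]
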